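/- Let $P\subset\mathbb R^n$ be a lattice polytope of dimension $D$ (the dimension of its affine hull). Its $h^*$-polynomial $h^*(P,x)$ is defined by $$1+\sum_{k\ge 1}|kP\cap\mathbb Z^n|\,x^k=\frac{h^*(P,x)}{(1-x)^{D+1}}.$$ A polynomial $f$ of degree $D$ is called $\gamma$-positive if $f(x)=x^Df(1/x)$ and there are real numbers $\gamma_0,\dots,\gamma_{\lfloor D/2\rfloor}\ge 0$ with $f(x)=\sum_{i=0}^{\lfloor D/2\rfloor}\gamma_i x^i(1+x)^{D-2i}$. Let $\mathbf e_1,\mathbf e_2,\dots$ denote the unit coordinate vectors. For $d\ge 3$ let $C_d$ be the cycle of length $d$ on the vertex set $\{1,\dots,d\}$ and let $$\mathcal A_{C_d}=\operatorname{conv}\{\pm(\mathbf e_i-\mathbf e_j):\{i,j\}\in E(C_d)\}\subset\mathbb R^d$$ be its symmetric edge polytope of type A. For $m\ge 1$ let $$V_{2m}=\operatorname{conv}(\pm\mathbf e_1,\dots,\pm\mathbf e_{2m},\pm(\mathbf e_1+\cdots+\mathbf e_{2m})),\qquad \widetilde V_{2m}=\operatorname{conv}(\pm\mathbf e_1,\dots,\pm\mathbf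 e_{2m},-\mathbf e_1-\cdots-\mathbf e_{2m})$$ in $\mathbb R^{2m}$ be the del Pezzo and the pseudo-del Pezzo polytope. Then, for all $d\ge 3$ and $m\ge 1$, $$h^*(\mathcal A_{C_d},x)=\sum_{i=0}^{\lfloor (d-1)/2\rfloor}\binom{2i}{i}x^i(x+1)^{d-2i-1},$$ $$h^*(V_{2m},x)=\sum_{i=0}^{m}\binom{2i}{i}x^i(x+1)^{2m-2i},$$ $$h^*(\widetilde V_{2m},x)=(x+1)^{2m}+\sum_{i=1}^{m}\binom{2i-1}{i-1}x^i(x+1)^{2m-2i}.$$ In particular, the $h^*$-polynomials of $\mathcal A_{C_d}$, $V_{2m}$ and $\widetilde V_{2m}$ are $\gamma$-positive. -/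

import Mathlib

noncomputable section

open scoped Pointwise

/-- The number of integer points in the dilate `k P`, for `P ⊆ ℝⁿ`. -/
def latticeCount {n : ℕ} (P : Set (Fin n → ℝ)) (k : ℕ) : ℕ :=
  Set.ncard {z : Fin n → ℤ | (fun i => (z i : ℝ)) ∈ (k : ℝ) • P}

/-- The Ehrhart series `1 + ∑_{k ≥ 1} |k P ∩ ℤⁿ| x ^ k`. -/
def ehrhartSeries {n : ℕ} (P : Set (Fin n → ℝ)) : PowerSeries ℤ :=
  PowerSeries.mk fun k => if k = 0 then 1 else (latticeCount P k : ℤ)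

/-- The dimension of `P`, that is, of its affine hull. -/
def polytopeDim {n : ℕ} (P : Set (Fin n → ℝ)) : ℕ :=
  Module.finrank ℝ (vectorSpan ℝ P)

/-- `h` is the `h^*`-polynomial of `P`: the Ehrhart series of `P` is `h / (1 - x) ^ (dim P + 1)`. -/
def IsHStarPolynomial {n : ℕ} (P : Set (Fin n → ℝ)) (h : Polynomial ℤ) : Prop :=
  ehrhartSeries P * (1 - PowerSeries.X) ^ (polytopeDim P + 1) = (h : PowerSeries ℤ)

/-- There is at most one `h^*`-polynomial. -/
theorem IsHStarPolynomial.unique {n : ℕ} {P : Set (Fin n → ℝ)} {h h' : Polynomial ℤ}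
    (H : IsHStarPolynomial P h) (H' : IsHStarPolynomial P h') : h = h' :=
  Polynomial.coe_injective ℤ (H.symm.trans H')

/-- `f` is `γ`-positive: it is palindromic, `f(x) = x ^ d f(1 / x)` for `d = deg f`, and
`f = ∑_{i ≤ d / 2} γ_i x ^ i (1 + x) ^ (d - 2 i)` with all `γ_i ≥ 0`. -/
def IsGammaPositive (f : Polynomial ℝ) : Prop :=
  f.reverse = f ∧ ∃ γ : ℕ → ℝ, (∀ i, 0 ≤ γ i) ∧
    f = ∑ i ∈ Finset.range (f.natDegree / 2 + 1),
      Polynomial.C (γ i) * Polynomial.X ^ i * (1 + Polynomial.X) ^ (f.natDegree - 2 * i)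

/-- The `i`-th unit coordinate vector of `ℝⁿ`. -/
def unitVec {n : ℕ} (i : Fin n) : Fin n → ℝ := Pi.single i 1

/-- The symmetric edge polytope of type A of a graph on `d` vertices: the convex hull of all
`± (e_i - e_j)` with `{i, j}` an edge (both signs occur since adjacency is symmetric). -/
def symmetricEdgePolytope {d : ℕ} (G : SimpleGraph (Fin d)) : Set (Fin d → ℝ) :=
  convexHull ℝ {v | ∃ i j, G.Adj i j ∧ v = unitVec i - unitVec j}

/-- The del Pezzo polytope `V_{2m}`. -/
def delPezzoPolytope (m : ℕ) : Set (Fin (2 * m) → ℝ) :=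
  convexHull ℝ ({v | ∃ i, v = unitVec i ∨ v = -unitVec i} ∪
    {∑ i, unitVec i, -∑ i, unitVec i})

/-- The pseudo-del Pezzo polytope `Ṽ_{2m}`. -/
def pseudoDelPezzoPolytope (m : ℕ) : Set (Fin (2 * m) → ℝ) :=
  convexHull ℝ ({v | ∃ i, v = unitVec i ∨ v = -unitVec i} ∪ {-∑ i, unitVec i})

end

/-! Each polytope is the image of a cross-polytope in `ℝ^N` under `c ↦ ∑ c i • v i`, where the `v i`
are unimodular with the single relation `∑ v i = 0` (`IsUnimodularCircuit`); for `Ṽ` the coefficient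
of `-∑ e_i` must moreover be nonnegative. Here `N = d` for the cycle and `N = 2m + 1` for the other
two.

For the cycle and `V`, a lattice point is a class of `ℤ^N` modulo constant vectors, and it lies in
`kP` iff some real translate of the class by a constant has `ℓ¹`-norm at most `k`. The norm is least
when the median is `0`, so requiring lower median `0` selects one integer representative per lattice
point (`exists_image_medianBall`). A sign argument turns the count of these into the sum of `sign (N
- 2 |pos w|)` over the `ℓ¹`-ball (`card_medianBall`). Points with positive set `S` have generating
function `x^|S| / (1 - x)^(N+1)`, and `dim P = N - 1`, so `(1 - x) h^* = ∑ sign (N - 2a) (N choose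
a) x^a`. Pascal's rule identifies this with `(1 - x)` times the claimed sum
(`one_sub_X_mul_centralGamma`).

The polytopes `Ṽ` and `-Ṽ` cover `V` and meet in the cross-polytope, also after dilation. Hence
`h^*(Ṽ)` is the average of `h^*(V)` and `(1 + x)^(2m)` (`two_mul_latticeCount_pseudo`). -/

noncomputable section

open scoped Pointwise

/-! ### Counting integer points of `ℓ¹`-balls by their positive coordinates -/

section Counting

set_option linter.unusedSectionVars false

variable {ι : Type*} [Fintype ι] [DecidableEq ι]

/-- The integer points of the `ℓ¹`-ball of radius `k`. -/
def l1Ball (ι : Type*) [Fintype ι] [DecidableEq ι] (k : ℕ) : Finset (ι → ℤ) :=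
  (Fintype.piFinset fun _ => Finset.Icc (-(k : ℤ)) k).filter fun w => ∑ i, (w i).natAbs ≤ k

theorem mem_l1Ball {k : ℕ} {w : ι → ℤ} : w ∈ l1Ball ι k ↔ ∑ i, (w i).natAbs ≤ k := by
  simp only [l1Ball, Finset.mem_filter, Fintype.mem_piFinset, Finset.mem_Icc, and_iff_right_iff_imp]
  intro h i
  have := Finset.single_le_sum (f := fun i => (w i).natAbs) (fun _ _ => Nat.zero_le _)
    (Finset.mem_univ i)
  omega

theorem l1Ball_zero : l1Ball ι 0 = {0} := by
  ext w
  simp [mem_l1Ball, funext_iff]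

/-- The set of coordinates at which `w` is positive. -/
def posSet (w : ι → ℤ) : Finset ι := Finset.univ.filter fun i => 0 < w i

theorem mem_posSet {w : ι → ℤ} {i : ι} : i ∈ posSet w ↔ 0 < w i := by simp [posSet]

/-- Stars and bars: the signs are fixed by `S`, so only the `|w i|` matter. Lowering them by `1` on
`S` and adding the slack as coordinate `none` leaves arbitrary natural numbers indexed by `Option ι`
with sum `k`. -/
theorem card_l1Ball_posSet_eq_add (S : Finset ι) (k : ℕ) :
    ((l1Ball ι (S.card + k)).filter fun w => posSet w = S).card =
      (Fintype.card ι + k).choose (Fintype.card ι) := by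
  have h := Finset.card_finsuppAntidiag_nat_eq_choose (s := (Finset.univ : Finset (Option ι))) k
  rw [Finset.card_univ, Fintype.card_option,
    show Fintype.card ι + 1 + k - 1 = Fintype.card ι + k by omega,
    ← Nat.choose_symm_add] at h
  rw [← h]
  have key : ∀ f : ι → ℕ, ∑ i, (f i + if i ∈ S then 1 else 0) = ∑ i, f i + S.card := by
    intro f
    rw [Finset.sum_add_distrib]
    simp
  refine Finset.card_bij'
    (fun w _ => Finsupp.equivFunOnFinite.symm fun o : Option ι =>
      o.elim (S.card + k - ∑ i, (w i).natAbs) fun i => (w i).natAbs - if i ∈ S then 1 else 0)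
    (fun l _ i => if i ∈ S then (l (some i) : ℤ) + 1 else -(l (some i) : ℤ)) ?_ ?_ ?_ ?_
  · intro w hw
    simp only [Finset.mem_filter, mem_l1Ball] at hw
    obtain ⟨hw, rfl⟩ := hw
    have h2 := key fun i => (w i).natAbs - if i ∈ posSet w then 1 else 0
    have h3 : ∀ i, ((w i).natAbs - if i ∈ posSet w then 1 else 0) + (if i ∈ posSet w then 1 else 0)
        = (w i).natAbs := by
      intro i
      split_ifs with hi
      · rw [mem_posSet] at hi; omega
      · rfl
    simp only [h3] at h2
    simp [Finset.mem_finsuppAntidiag, Fintype.sum_option]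
    omega
  · intro l hl
    simp only [Finset.mem_finsuppAntidiag, Fintype.sum_option] at hl
    have h2 := key fun i => l (some i)
    simp only [Finset.mem_filter, mem_l1Ball]
    constructor
    · have h3 : ∀ i, (if i ∈ S then (l (some i) : ℤ) + 1 else -(l (some i) : ℤ)).natAbs =
          l (some i) + if i ∈ S then 1 else 0 := by
        intro i
        split_ifs <;> omega
      simp only [h3]
      omega
    · ext i
      rw [mem_posSet]
      split_ifs with hi
      · simp only [hi, iff_true]; omega
      · simp only [hi, iff_false]; omega
  · intro w hw
    simp only [Finset.mem_filter, mem_l1Ball] at hw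
    obtain ⟨hw, rfl⟩ := hw
    ext i
    by_cases hi : i ∈ posSet w
    · have := mem_posSet.1 hi
      simp [hi]; omega
    · have := mt mem_posSet.2 hi
      simp [hi, abs_of_nonpos (not_lt.1 this)]
  · intro l hl
    simp only [Finset.mem_finsuppAntidiag, Fintype.sum_option] at hl
    have h2 := key fun i => l (some i)
    have h3 : ∀ i, (if i ∈ S then (l (some i) : ℤ) + 1 else -(l (some i) : ℤ)).natAbs =
        l (some i) + if i ∈ S then 1 else 0 := by
      intro i
      split_ifs <;> omega
    ext o
    rcases o with _ | i
    · simp [h3, Finset.sum_add_distrib]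
      omega
    · simp [h3]

theorem card_posSet_le_of_mem_l1Ball {k : ℕ} {w : ι → ℤ} (hw : w ∈ l1Ball ι k) :
    (posSet w).card ≤ k := by
  refine le_trans ?_ (mem_l1Ball.1 hw)
  rw [Finset.card_eq_sum_ones]
  calc ∑ i ∈ posSet w, 1 ≤ ∑ i ∈ posSet w, (w i).natAbs :=
        Finset.sum_le_sum fun i hi => by have := mem_posSet.1 hi; omega
    _ ≤ _ := Finset.sum_le_sum_of_subset (Finset.subset_univ _)

theorem card_l1Ball_posSet_eq (S : Finset ι) (k : ℕ) :
    (((l1Ball ι k).filter fun w => posSet w = S).card : ℤ) =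
      PowerSeries.coeff k ((PowerSeries.X : PowerSeries ℤ) ^ S.card *
        PowerSeries.mk 1 ^ (Fintype.card ι + 1)) := by
  rw [PowerSeries.coeff_X_pow_mul', PowerSeries.mk_one_pow_eq_mk_choose_add, PowerSeries.coeff_mk]
  split_ifs with h
  · obtain ⟨j, rfl⟩ := Nat.exists_eq_add_of_le h
    rw [card_l1Ball_posSet_eq_add, Nat.add_sub_cancel_left]
  · rw [Nat.cast_eq_zero, Finset.card_eq_zero, Finset.filter_eq_empty_iff]
    rintro w hw rfl
    exact h (card_posSet_le_of_mem_l1Ball hw)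

/-- Splitting the ball by positive set, each `S` contributes `f |S| x^|S| / (1 - x)^(N+1)`; this
depends only on `|S|`, whence the binomial coefficients. -/
theorem mk_sum_l1Ball_mul_one_sub_pow (f : ℕ → ℤ) :
    (PowerSeries.mk fun k => ∑ w ∈ l1Ball ι k, f (posSet w).card) *
        (1 - PowerSeries.X) ^ (Fintype.card ι + 1) =
      ∑ a ∈ Finset.range (Fintype.card ι + 1),
        PowerSeries.C ((Fintype.card ι).choose a * f a) * PowerSeries.X ^ a := by
  have h1 : (PowerSeries.mk fun k => ∑ w ∈ l1Ball ι k, f (posSet w).card) =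
      (∑ S ∈ (Finset.univ : Finset ι).powerset, PowerSeries.C (f S.card) *
        PowerSeries.X ^ S.card) * PowerSeries.mk 1 ^ (Fintype.card ι + 1) := by
    ext k
    rw [PowerSeries.coeff_mk, Finset.sum_mul, map_sum,
      ← Finset.sum_fiberwise_of_maps_to (t := (Finset.univ : Finset ι).powerset) (g := posSet)
        (by simp)]
    refine Finset.sum_congr rfl fun S _ => ?_
    rw [mul_assoc, PowerSeries.coeff_C_mul, ← card_l1Ball_posSet_eq,
      Finset.sum_congr rfl (g := fun _ => f S.card)
        (fun w hw => by rw [(Finset.mem_filter.1 hw).2]), Finset.sum_const, nsmul_eq_mul, mul_comm]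
  rw [h1, mul_assoc, ← mul_pow, PowerSeries.mk_one_mul_one_sub_eq_one, one_pow, mul_one,
    Finset.sum_powerset_apply_card (fun a => PowerSeries.C (f a) * PowerSeries.X ^ a),
    Finset.card_univ]
  refine Finset.sum_congr rfl fun a _ => ?_
  rw [map_mul, nsmul_eq_mul, mul_assoc]
  simp

end Counting

/-! ### Lower medians -/

section Median

set_option linter.unusedSectionVars false

variable {ι : Type*} [Fintype ι] [DecidableEq ι]

/-- `t` is the lower median of the entries of `w`. -/
def IsLowerMedian (w : ι → ℤ) (t : ℤ) : Prop :=
  2 * (Finset.univ.filter fun i => t < w i).card ≤ Fintype.card ι ∧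
    2 * (Finset.univ.filter fun i => w i < t).card < Fintype.card ι

theorem card_filter_lt_add_card_filter_le (w : ι → ℤ) (t : ℤ) :
    (Finset.univ.filter fun i => t < w i).card + (Finset.univ.filter fun i => w i ≤ t).card =
      Fintype.card ι := by
  rw [← Finset.card_univ, ← Finset.card_filter_add_card_filter_not (s := Finset.univ)
    (fun i => t < w i)]
  simp only [not_lt]

theorem exists_isLowerMedian [Nonempty ι] (w : ι → ℤ) : ∃ t, IsLowerMedian w t := by
  obtain ⟨M, hM⟩ := (Set.finite_range w).bddAbove
  obtain ⟨m, hm⟩ := (Set.finite_range w).bddBelow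
  obtain ⟨t, ht, hmin⟩ := Int.exists_least_of_bdd
    (P := fun t => 2 * (Finset.univ.filter fun i => t < w i).card ≤ Fintype.card ι)
    ⟨m, fun t ht => by
      by_contra! hlt
      rw [Finset.filter_true_of_mem
        (fun i _ => hlt.trans_le (hm (Set.mem_range_self i))), Finset.card_univ] at ht
      have := Fintype.card_pos (α := ι)
      omega⟩
    ⟨M, by
      rw [Finset.filter_false_of_mem (fun i _ => not_lt.2 (hM (Set.mem_range_self i)))]
      simp⟩
  refine ⟨t, ht, ?_⟩
  -- Minimality of `t` says more than half of the entries exceed `t - 1`, so fewer than half are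
  -- below `t`.
  have h := mt (hmin (t - 1)) (by omega)
  have h2 := card_filter_lt_add_card_filter_le w (t - 1)
  simp only [Int.le_sub_one_iff] at h2
  omega

theorem IsLowerMedian.le {w : ι → ℤ} {s t : ℤ} (hs : IsLowerMedian w s)
    (ht : IsLowerMedian w t) : t ≤ s := by
  by_contra! hlt
  have h := card_filter_lt_add_card_filter_le w s
  have h2 : (Finset.univ.filter fun i => w i ≤ s).card ≤
      (Finset.univ.filter fun i => w i < t).card :=
    Finset.card_le_card fun i => by simp only [Finset.mem_filter, Finset.mem_univ, true_and]; omega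
  have := hs.1
  have := ht.2
  omega

theorem IsLowerMedian.unique {w : ι → ℤ} {s t : ℤ} (hs : IsLowerMedian w s)
    (ht : IsLowerMedian w t) : s = t := le_antisymm (ht.le hs) (hs.le ht)

theorem isLowerMedian_add_const {w : ι → ℤ} {s t : ℤ} :
    IsLowerMedian (fun i => w i + s) (t + s) ↔ IsLowerMedian w t := by
  simp [IsLowerMedian]

/-- The lower median minimizes the sum of distances to the entries. -/
theorem IsLowerMedian.sum_abs_sub_le {w : ι → ℤ} {t : ℤ} (ht : IsLowerMedian w t) (s : ℝ) :
    ∑ i, |(w i : ℝ) - t| ≤ ∑ i, |(w i : ℝ) - s| := by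
  rw [← sub_nonneg, ← Finset.sum_sub_distrib]
  have hsum : ∀ (p : ι → Prop) [DecidablePred p] (a b : ℝ),
      ∑ i, (if p i then a else b) = a * (Finset.univ.filter p).card +
        b * (Fintype.card ι - (Finset.univ.filter p).card) := by
    intro p _ a b
    have h := Finset.card_filter_add_card_filter_not (s := (Finset.univ : Finset ι)) p
    rw [Finset.card_univ] at h
    rw [← h, Finset.sum_ite]
    simp
    ring
  rcases le_total (t : ℝ) s with hst | hst
  -- Moving from `t` to `s ≥ t` shortens a distance by at most `s - t` for entries above `t` and
  -- lengthens it by exactly `s - t` for the others, which are at least half.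
  · refine le_trans ?_ (Finset.sum_le_sum (f := fun i => if t < w i then -(s - t) else s - t) ?_)
    · rw [hsum]
      have := ht.1
      have h3 : (2 * (Finset.univ.filter fun i => t < w i).card : ℝ) ≤ Fintype.card ι := by
        exact_mod_cast this
      nlinarith
    · intro i _
      split_ifs with hi
      · have := abs_sub_abs_le_abs_sub ((w i : ℝ) - t) (w i - s)
        rw [show (w i : ℝ) - t - (w i - s) = s - t by ring, abs_of_nonneg (sub_nonneg.2 hst)] at this
        linarith
      · have hi' : (w i : ℝ) ≤ t := by exact_mod_cast not_lt.1 hi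
        rw [abs_of_nonpos (by linarith), abs_of_nonpos (by linarith)]
        linarith
  · refine le_trans ?_ (Finset.sum_le_sum (f := fun i => if w i < t then -(t - s) else t - s) ?_)
    · rw [hsum]
      have := ht.2.le
      have h3 : (2 * (Finset.univ.filter fun i => w i < t).card : ℝ) ≤ Fintype.card ι := by
        exact_mod_cast this
      nlinarith
    · intro i _
      split_ifs with hi
      · have := abs_sub_abs_le_abs_sub ((w i : ℝ) - t) (w i - s)
        rw [show (w i : ℝ) - t - (w i - s) = -(t - s) by ring, abs_neg,
          abs_of_nonneg (sub_nonneg.2 hst)] at this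
        linarith
      · have hi' : (t : ℝ) ≤ w i := by exact_mod_cast not_lt.1 hi
        rw [abs_of_nonneg (by linarith), abs_of_nonneg (by linarith)]
        linarith

instance (t : ℤ) : DecidablePred fun w : ι → ℤ => IsLowerMedian w t := fun _ => instDecidableAnd

/-- The integer points of the `ℓ¹`-ball of radius `k` with lower median `0`. -/
def medianBall (ι : Type*) [Fintype ι] [DecidableEq ι] (k : ℕ) : Finset (ι → ℤ) :=
  (l1Ball ι k).filter fun w => IsLowerMedian w 0

theorem mem_medianBall {k : ℕ} {w : ι → ℤ} :
    w ∈ medianBall ι k ↔ ∑ i, (w i).natAbs ≤ k ∧ IsLowerMedian w 0 := by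
  rw [medianBall, Finset.mem_filter, mem_l1Ball]

/-- The sign of `N - 2 a`. -/
def balanceSign (N a : ℕ) : ℤ :=
  1 - (if N < 2 * a then 1 else 0) - if N ≤ 2 * a then 1 else 0

/-- The conditions `2 |pos w| > N` and `2 |neg w| ≥ N` exclude each other, so the indicator of lower
median `0` is `1` minus both indicators. The symmetry `w ↦ -w` of the ball makes the second a
condition on `pos w`. -/
theorem card_medianBall (k : ℕ) :
    ((medianBall ι k).card : ℤ) =
      ∑ w ∈ l1Ball ι k, balanceSign (Fintype.card ι) (posSet w).card := by
  have hneg : ∑ w ∈ l1Ball ι k, (if Fintype.card ι ≤ 2 * (posSet w).card then (1 : ℤ) else 0) =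
      ∑ w ∈ l1Ball ι k, if Fintype.card ι ≤ 2 * (posSet (-w)).card then (1 : ℤ) else 0 :=
    Finset.sum_nbij' (fun w => -w) (fun w => -w) (by simp [mem_l1Ball]) (by simp [mem_l1Ball])
      (by simp) (by simp) (by simp)
  simp only [balanceSign, Finset.sum_sub_distrib]
  rw [hneg, ← Finset.sum_sub_distrib, ← Finset.sum_sub_distrib, medianBall, Finset.card_filter]
  push_cast
  refine Finset.sum_congr rfl fun w _ => ?_
  have hle : (posSet w).card + (posSet (-w)).card ≤ Fintype.card ι := by
    rw [← Finset.card_union_of_disjoint, ← Finset.card_univ]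
    · exact Finset.card_le_card (Finset.subset_univ _)
    · rw [Finset.disjoint_left]
      intro i hi hi'
      rw [mem_posSet] at hi hi'
      simp only [Pi.neg_apply] at hi'
      omega
  have hiff : IsLowerMedian w 0 ↔
      2 * (posSet w).card ≤ Fintype.card ι ∧ 2 * (posSet (-w)).card < Fintype.card ι := by
    simp [IsLowerMedian, posSet]
  rw [if_congr hiff rfl rfl]
  split_ifs <;> omega

theorem medianBall_zero [Nonempty ι] : medianBall ι 0 = {0} := by
  rw [medianBall, l1Ball_zero, Finset.filter_true_of_mem]
  simp [IsLowerMedian, Fintype.card_pos]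

end Median

/-! ### The polynomials -/

section Polynomials

open Polynomial

/-- The polynomial `∑ i ≤ n / 2, (2 i choose i) X ^ i (X + 1) ^ (n - 2 i)`. -/
def centralGamma (n : ℕ) : ℤ[X] :=
  ∑ i ∈ Finset.range (n / 2 + 1), ((2 * i).choose i : ℤ[X]) * X ^ i * (X + 1) ^ (n - 2 * i)

theorem centralGamma_two_mul_succ (p : ℕ) :
    centralGamma (2 * p + 1) = (X + 1) * centralGamma (2 * p) := by
  unfold centralGamma
  rw [show (2 * p + 1) / 2 = p by omega, show 2 * p / 2 = p by omega, Finset.mul_sum]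
  refine Finset.sum_congr rfl fun i hi => ?_
  rw [Finset.mem_range] at hi
  rw [show 2 * p + 1 - 2 * i = (2 * p - 2 * i) + 1 by omega]
  ring

theorem centralGamma_two_mul_add_two (p : ℕ) :
    centralGamma (2 * p + 2) = (X + 1) * centralGamma (2 * p + 1) +
      ((2 * (p + 1)).choose (p + 1) : ℤ[X]) * X ^ (p + 1) := by
  unfold centralGamma
  rw [show (2 * p + 2) / 2 = p + 1 by omega, show (2 * p + 1) / 2 = p by omega,
    Finset.sum_range_succ _ (p + 1), Finset.mul_sum,
    show 2 * p + 2 - 2 * (p + 1) = 0 by omega, pow_zero, mul_one]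
  congr 1
  refine Finset.sum_congr rfl fun i hi => ?_
  rw [Finset.mem_range] at hi
  rw [show 2 * p + 2 - 2 * i = (2 * p + 1 - 2 * i) + 1 by omega]
  ring

/-- The polynomial `∑ a, sign (N - 2 a) (N choose a) X ^ a`. -/
def signedBinomial (N : ℕ) : ℤ[X] :=
  ∑ a ∈ Finset.range (N + 1), C (N.choose a * balanceSign N a) * X ^ a

theorem coeff_signedBinomial (N a : ℕ) :
    (signedBinomial N).coeff a = N.choose a * balanceSign N a := by
  simp only [signedBinomial, finsetSum_coeff, coeff_C_mul, coeff_X_pow, mul_ite, mul_one, mul_zero,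
    Finset.sum_ite_eq, Finset.mem_range]
  split_ifs with h
  · rfl
  · rw [Nat.choose_eq_zero_of_lt (by omega)]; simp

/-- Pascal's rule respects the signs except at the middle coefficient of row `2p`: its sign is `0`,
but it enters row `2p + 1` with sign `+` at `X ^ p` and `-` at `X ^ (p + 1)`. -/
theorem signedBinomial_two_mul_succ (p : ℕ) :
    signedBinomial (2 * p + 1) = (X + 1) * signedBinomial (2 * p) +
      (1 - X) * (((2 * p).choose p : ℤ[X]) * X ^ p) := by
  rw [show (1 - X : ℤ[X]) * (((2 * p).choose p : ℤ[X]) * X ^ p) =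
    ((2 * p).choose p : ℤ[X]) * X ^ p - ((2 * p).choose p : ℤ[X]) * X ^ (p + 1) by ring]
  ext a
  rw [add_mul, one_mul]
  rcases a with _ | a
  · simp only [coeff_add, coeff_sub, coeff_signedBinomial, coeff_X_pow,
      mul_coeff_zero, coeff_X_zero]
    rcases p with _ | p <;> simp [balanceSign]
  · simp only [coeff_add, coeff_sub, coeff_signedBinomial, coeff_natCast_mul, coeff_X_pow,
      coeff_X_mul, Nat.choose_succ_succ' (2 * p) a, balanceSign]
    push_cast
    rcases lt_trichotomy (a + 1) p with h | h | h
    · simp [show ¬ (2 * p + 1 < 2 * (a + 1)) by omega, show ¬ (2 * p + 1 ≤ 2 * (a + 1)) by omega,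
        show ¬ (2 * p < 2 * (a + 1)) by omega, show ¬ (2 * p ≤ 2 * (a + 1)) by omega,
        show ¬ (2 * p < 2 * a) by omega, show ¬ (2 * p ≤ 2 * a) by omega,
        show a + 1 ≠ p by omega, show a ≠ p by omega]
    · subst h
      simp
    · rcases eq_or_lt_of_le (Nat.lt_succ_iff.1 h) with h | h
      · subst h
        have e : 2 * p + 1 < 2 * (p + 1) := by omega
        rw [if_pos e, if_pos e.le]
        simp
      · simp [show (2 * p + 1 < 2 * (a + 1)) by omega, show (2 * p + 1 ≤ 2 * (a + 1)) by omega,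
        show (2 * p < 2 * (a + 1)) by omega, show (2 * p ≤ 2 * (a + 1)) by omega,
        show (2 * p < 2 * a) by omega, show (2 * p ≤ 2 * a) by omega,
        show a + 1 ≠ p by omega, show a ≠ p by omega]
        ring

/-- No correction arises here: the two middle coefficients of row `2p + 1` are equal with opposite
signs and cancel. -/
theorem signedBinomial_two_mul_add_two (p : ℕ) :
    signedBinomial (2 * p + 2) = (X + 1) * signedBinomial (2 * p + 1) := by
  ext a
  rw [add_mul, one_mul]
  rcases a with _ | a
  · simp only [coeff_add, coeff_signedBinomial, mul_coeff_zero, coeff_X_zero]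
    simp [balanceSign]
  · simp only [coeff_add, coeff_signedBinomial, coeff_X_mul, Nat.choose_succ_succ' (2 * p + 1) a,
      balanceSign]
    push_cast
    rcases lt_trichotomy a p with h | h | h
    · simp [show ¬ (2 * p + 2 < 2 * (a + 1)) by omega, show ¬ (2 * p + 2 ≤ 2 * (a + 1)) by omega,
        show ¬ (2 * p + 1 < 2 * (a + 1)) by omega, show ¬ (2 * p + 1 ≤ 2 * (a + 1)) by omega,
        show ¬ (2 * p + 1 < 2 * a) by omega, show ¬ (2 * p + 1 ≤ 2 * a) by omega]
    · subst h
      rw [Nat.choose_symm_half]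
      simp [show ¬ (2 * a + 2 < 2 * (a + 1)) by omega, show (2 * a + 2 ≤ 2 * (a + 1)) by omega,
        show (2 * a + 1 < 2 * (a + 1)) by omega, show (2 * a + 1 ≤ 2 * (a + 1)) by omega]
    · simp [show (2 * p + 2 < 2 * (a + 1)) by omega, show (2 * p + 2 ≤ 2 * (a + 1)) by omega,
        show (2 * p + 1 < 2 * (a + 1)) by omega, show (2 * p + 1 ≤ 2 * (a + 1)) by omega,
        show (2 * p + 1 < 2 * a) by omega, show (2 * p + 1 ≤ 2 * a) by omega]
      ring

theorem one_sub_X_mul_centralGamma (n : ℕ) :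
    (1 - X) * centralGamma n = signedBinomial (n + 1) := by
  have key : ∀ p : ℕ, (1 - X) * centralGamma (2 * p) = signedBinomial (2 * p + 1) := by
    intro p
    induction p with
    | zero => simp [centralGamma, signedBinomial, balanceSign, Finset.sum_range_succ]; ring
    | succ p ih =>
      rw [show 2 * (p + 1) = 2 * p + 2 by ring, centralGamma_two_mul_add_two,
        centralGamma_two_mul_succ, show 2 * p + 2 + 1 = 2 * (p + 1) + 1 by ring,
        signedBinomial_two_mul_succ, show 2 * (p + 1) = 2 * p + 2 by ring,
        signedBinomial_two_mul_add_two, ← ih]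
      ring
  obtain ⟨p, rfl | rfl⟩ := n.even_or_odd'
  · exact key p
  · rw [centralGamma_two_mul_succ, signedBinomial_two_mul_add_two, ← key p]
    ring

theorem two_mul_pseudoGamma (m : ℕ) :
    2 * ((X + 1 : ℤ[X]) ^ (2 * m) + ∑ i ∈ Finset.Icc 1 m,
      ((2 * i - 1).choose (i - 1) : ℤ[X]) * X ^ i * (X + 1) ^ (2 * m - 2 * i)) =
    (X + 1) ^ (2 * m) + centralGamma (2 * m) := by
  rw [centralGamma, show 2 * m / 2 = m by omega, Finset.range_eq_Ico, Finset.sum_eq_sum_Ico_succ_bot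
    (by omega)]
  simp only [mul_zero, Nat.choose_self, Nat.cast_one, pow_zero, mul_one, one_mul, Nat.sub_zero,
    mul_add, Finset.mul_sum]
  rw [two_mul, add_assoc, zero_add]
  congr 2
  refine Finset.sum_congr (by ext; simp) fun i hi => ?_
  rw [Finset.mem_Ico] at hi
  obtain ⟨j, rfl⟩ := Nat.exists_eq_add_of_le' hi.1
  have h : (2 * (j + 1)).choose (j + 1) = 2 * (2 * (j + 1) - 1).choose (j + 1 - 1) := by
    rw [show 2 * (j + 1) = 2 * j + 1 + 1 by ring, Nat.choose_succ_succ', Nat.choose_symm_half,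
      Nat.add_sub_cancel, Nat.add_sub_cancel]
    ring
  rw [h]
  push_cast
  ring

theorem reflect_X_add_one_pow {R : Type*} [CommSemiring R] (k : ℕ) :
    reflect k ((1 + X : R[X]) ^ k) = (1 + X) ^ k := by
  ext a
  rw [coeff_reflect, coeff_one_add_X_pow, coeff_one_add_X_pow]
  rcases le_or_gt a k with h | h
  · rw [revAt_le h, Nat.choose_symm h]
  · rw [revAt_eq_self_of_lt h]

/-- A nonnegative combination of the `X ^ i (1 + X) ^ (d - 2 i)` in which `(1 + X) ^ d` occurs
is `γ`-positive. -/
theorem isGammaPositive_of_eq_sum {f : ℝ[X]} (d : ℕ) (γ : ℕ → ℝ) (h0 : γ 0 ≠ 0)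
    (hγ : ∀ i, 0 ≤ γ i)
    (hf : f = ∑ i ∈ Finset.range (d / 2 + 1), C (γ i) * X ^ i * (1 + X) ^ (d - 2 * i)) :
    IsGammaPositive f := by
  have hdeg1 : ∀ k, ((1 + X : ℝ[X]) ^ k).natDegree = k := fun k => by
    rw [natDegree_pow, add_comm, ← C_1, natDegree_X_add_C, mul_one]
  have hterm : ∀ i, (C (γ i) * X ^ i * (1 + X) ^ (d - 2 * i) : ℝ[X]).natDegree ≤
      i + (d - 2 * i) := fun i =>
    natDegree_mul_le.trans (add_le_add (natDegree_C_mul_X_pow_le _ _) (hdeg1 _).le)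
  have hle : f.natDegree ≤ d := by
    rw [hf]
    refine natDegree_sum_le_of_forall_le _ _ fun i hi => (hterm i).trans ?_
    rw [Finset.mem_range] at hi
    omega
  have hcoeff : f.coeff d = γ 0 := by
    rw [hf, finsetSum_coeff, Finset.sum_eq_single 0]
    · rw [pow_zero, mul_one, coeff_C_mul, mul_zero, Nat.sub_zero, coeff_one_add_X_pow,
        Nat.choose_self, Nat.cast_one, mul_one]
    · intro i hi hi0
      rw [Finset.mem_range] at hi
      exact coeff_eq_zero_of_natDegree_lt ((hterm i).trans_lt (by omega))
    · simp
  have hd : f.natDegree = d :=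
    le_antisymm hle (le_natDegree_of_ne_zero (by rw [hcoeff]; exact h0))
  refine ⟨?_, γ, hγ, by rw [hd]; exact hf⟩
  have hsum : ∀ s : Finset ℕ, ∀ g : ℕ → ℝ[X], reflect d (∑ i ∈ s, g i) = ∑ i ∈ s, reflect d (g i) := by
    intro s g
    ext a
    simp only [coeff_reflect, finsetSum_coeff]
  rw [reverse, hd]
  conv_lhs => rw [hf]
  rw [hsum]
  conv_rhs => rw [hf]
  refine Finset.sum_congr rfl fun i hi => ?_
  rw [Finset.mem_range] at hi
  -- Reflection at `2 * i` fixes `X ^ i`, so each summand is palindromic about `d / 2`.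
  have h := reflect_mul (C (γ i) * X ^ i) ((1 + X : ℝ[X]) ^ (d - 2 * i)) (F := 2 * i)
    (G := d - 2 * i) ((natDegree_C_mul_X_pow_le _ _).trans (by omega)) (hdeg1 _).le
  rw [show 2 * i + (d - 2 * i) = d by omega] at h
  rw [h, reflect_X_add_one_pow, reflect_C_mul_X_pow, revAt_le (by omega),
    show 2 * i - i = i by omega]

end Polynomials

/-! ### Hulls of vectors and their negatives -/

section AbsHull

set_option linter.unusedSectionVars false

variable {ι : Type*} [Fintype ι] [DecidableEq ι] {n : ℕ}

/-- The combinations `∑ i, c i • v i` with `∑ i, |c i| ≤ r` and coefficient vector in `K`. -/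
def absHull (v : ι → Fin n → ℝ) (K : Set (ι → ℝ)) (r : ℝ) : Set (Fin n → ℝ) :=
  {x | ∃ c ∈ K, ∑ i, |c i| ≤ r ∧ Fintype.linearCombination ℝ v c = x}

theorem Convex.sum_smul_mem_of_sum_le_one {E : Type*} [AddCommGroup E] [Module ℝ E] {S : Set E}
    (hS : Convex ℝ S) (h0 : (0 : E) ∈ S) {a : ι → ℝ} {u : ι → E} (ha : ∀ i, 0 ≤ a i)
    (h1 : ∑ i, a i ≤ 1) (hu : ∀ i, u i ∈ S) : ∑ i, a i • u i ∈ S := by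
  -- The missing weight `1 - ∑ a i` is placed on the point `0`.
  have h := hS.sum_mem (t := (Finset.univ : Finset (Option ι)))
    (w := fun o => o.elim (1 - ∑ i, a i) a) (z := fun o => o.elim 0 u)
    (by rintro (_ | i) _; exacts [sub_nonneg.2 h1, ha i])
    (by simp [Fintype.sum_option])
    (by rintro (_ | i) _; exacts [h0, hu i])
  simpa [Fintype.sum_option] using h

theorem sum_abs_combo_le {c c' : ι → ℝ} {r a b : ℝ} (hc : ∑ i, |c i| ≤ r) (hc' : ∑ i, |c' i| ≤ r)
    (ha : 0 ≤ a) (hb : 0 ≤ b) (hab : a + b = 1) : ∑ i, |(a • c + b • c') i| ≤ r := by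
  calc ∑ i, |(a • c + b • c') i| ≤ ∑ i, (a * |c i| + b * |c' i|) :=
        Finset.sum_le_sum fun i _ => by
          simp only [Pi.add_apply, Pi.smul_apply, smul_eq_mul]
          refine (abs_add_le _ _).trans ?_
          rw [abs_mul, abs_mul, abs_of_nonneg ha, abs_of_nonneg hb]
    _ = a * ∑ i, |c i| + b * ∑ i, |c' i| := by
        rw [Finset.sum_add_distrib, Finset.mul_sum, Finset.mul_sum]
    _ ≤ a * r + b * r := by gcongr
    _ = r := by rw [← add_mul, hab, one_mul]

theorem convex_absHull (v : ι → Fin n → ℝ) {K : Set (ι → ℝ)} (hK : Convex ℝ K) (r : ℝ) :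
    Convex ℝ (absHull v K r) := by
  rintro _ ⟨c, hc, hcr, rfl⟩ _ ⟨c', hc', hcr', rfl⟩ a b ha hb hab
  exact ⟨a • c + b • c', hK hc hc' ha hb hab, sum_abs_combo_le hcr hcr' ha hb hab, by simp⟩

/-- Since `c i • v i = |c i| • (± v i)`, only the signs occurring in `K` need a generator in `S`;
this is what lets `K` encode the one-sided generator of `Ṽ`. -/
theorem convexHull_eq_absHull {v : ι → Fin n → ℝ} {K : Set (ι → ℝ)} (hK : Convex ℝ K)
    {S : Set (Fin n → ℝ)} (hS : S ⊆ absHull v K 1) (h0 : (0 : Fin n → ℝ) ∈ convexHull ℝ S)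
    (hpos : ∀ c ∈ K, ∀ i, 0 < c i → v i ∈ S) (hneg : ∀ c ∈ K, ∀ i, c i < 0 → -v i ∈ S) :
    convexHull ℝ S = absHull v K 1 := by
  refine Set.Subset.antisymm (convexHull_min hS (convex_absHull v hK 1)) ?_
  rintro _ ⟨c, hc, hc1, rfl⟩
  have h := (convex_convexHull ℝ S).sum_smul_mem_of_sum_le_one h0 (a := fun i => |c i|)
    (u := fun i => if 0 < c i then v i else if c i < 0 then -v i else 0) (fun i => abs_nonneg _) hc1
    (fun i => by
      split_ifs with h1 h2
      · exact subset_convexHull ℝ S (hpos c hc i h1)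
      · exact subset_convexHull ℝ S (hneg c hc i h2)
      · exact h0)
  rw [Fintype.linearCombination_apply]
  convert h using 2 with i
  split_ifs with h1 h2
  · rw [abs_of_pos h1]
  · rw [abs_of_neg h2, neg_smul_neg]
  · rw [le_antisymm (not_lt.1 h1) (not_lt.1 h2), abs_zero, zero_smul, zero_smul]

theorem zero_mem_convexHull_of_neg_mem {S : Set (Fin n → ℝ)} {x : Fin n → ℝ} (h : x ∈ S)
    (h' : -x ∈ S) : (0 : Fin n → ℝ) ∈ convexHull ℝ S := by
  have := convex_convexHull ℝ S (subset_convexHull ℝ S h) (subset_convexHull ℝ S h')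
    (a := 1 / 2) (b := 1 / 2) (by norm_num) (by norm_num) (by norm_num)
  simpa using this

theorem mem_smul_absHull {v : ι → Fin n → ℝ} {K : Set (ι → ℝ)}
    (hK : ∀ c ∈ K, ∀ r : ℝ, 0 < r → r • c ∈ K) {k : ℝ} (hk : 0 < k) :
    k • absHull v K 1 = absHull v K k := by
  ext x
  rw [Set.mem_smul_set_iff_inv_smul_mem₀ hk.ne']
  constructor
  · rintro ⟨c, hc, hc1, hx⟩
    refine ⟨k • c, hK c hc k hk, ?_, ?_⟩
    · simp only [Pi.smul_apply, smul_eq_mul, abs_mul, abs_of_pos hk, ← Finset.mul_sum]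
      nlinarith
    · rw [map_smul, hx, smul_inv_smul₀ hk.ne']
  · rintro ⟨c, hc, hc1, rfl⟩
    refine ⟨k⁻¹ • c, hK c hc _ (inv_pos.2 hk), ?_, by rw [map_smul]⟩
    simp only [Pi.smul_apply, smul_eq_mul, abs_mul, abs_of_pos (inv_pos.2 hk), ← Finset.mul_sum]
    rw [inv_mul_le_iff₀ hk, mul_one]
    exact hc1

/-- The only linear relation among the vectors `v i` is that they sum to `0`, and they form a
unimodular family of integer vectors. -/
structure IsUnimodularCircuit (v : ι → Fin n → ℝ) : Prop where
  map_const : ∀ s : ℝ, Fintype.linearCombination ℝ v (fun _ => s) = 0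
  const_of_map_eq_zero : ∀ c, Fintype.linearCombination ℝ v c = 0 → ∃ s : ℝ, c = fun _ => s
  exists_int : ∀ w : ι → ℤ, ∃ z : Fin n → ℤ,
    Fintype.linearCombination ℝ v (fun i => (w i : ℝ)) = fun i => (z i : ℝ)
  exists_lift : ∀ (c : ι → ℝ) (z : Fin n → ℤ),
    Fintype.linearCombination ℝ v c = (fun i => (z i : ℝ)) →
      ∃ (w : ι → ℤ) (s : ℝ), c = fun i => (w i : ℝ) + s

namespace IsUnimodularCircuit

variable {v : ι → Fin n → ℝ}

theorem finrank_range [Nonempty ι] (hv : IsUnimodularCircuit v) :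
    Module.finrank ℝ (LinearMap.range (Fintype.linearCombination ℝ v)) + 1 = Fintype.card ι := by
  have h := LinearMap.finrank_range_add_finrank_ker (Fintype.linearCombination ℝ v)
  rw [Module.finrank_fintype_fun_eq_card] at h
  have hker : LinearMap.ker (Fintype.linearCombination ℝ v) = ℝ ∙ (fun _ : ι => (1 : ℝ)) := by
    ext c
    rw [LinearMap.mem_ker, Submodule.mem_span_singleton]
    constructor
    · intro hc
      obtain ⟨s, rfl⟩ := hv.const_of_map_eq_zero c hc
      exact ⟨s, by ext; simp⟩
    · rintro ⟨s, rfl⟩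
      convert hv.map_const s using 2
      ext; simp
  rw [hker, finrank_span_singleton (fun h0 => one_ne_zero (congrFun h0 (Classical.arbitrary ι)))] at h
  exact h

theorem polytopeDim_absHull [Nonempty ι] (hv : IsUnimodularCircuit v) {K : Set (ι → ℝ)}
    (h0 : (0 : ι → ℝ) ∈ K) (h1 : ∀ i, Pi.single i 1 ∈ K) :
    polytopeDim (absHull v K 1) + 1 = Fintype.card ι := by
  have h : vectorSpan ℝ (absHull v K 1) = LinearMap.range (Fintype.linearCombination ℝ v) := by
    apply le_antisymm
    · rw [vectorSpan_def, Submodule.span_le]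
      rintro _ ⟨_, ⟨c, _, _, rfl⟩, _, ⟨c', _, _, rfl⟩, rfl⟩
      exact ⟨c - c', by simp⟩
    · rw [Fintype.range_linearCombination, Submodule.span_le]
      rintro _ ⟨i, rfl⟩
      have := vsub_mem_vectorSpan ℝ (s := absHull v K 1) (p₁ := v i) (p₂ := 0)
        ⟨Pi.single i 1, h1 i, by
          simp [Pi.single_apply, apply_ite abs], by simp⟩ ⟨0, h0, by simp, by simp⟩
      simpa using this
  rw [polytopeDim, h, hv.finrank_range]

/-- The integer points of the `k`-th dilate correspond to the points of `medianBall`. -/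
theorem exists_image_medianBall [Nonempty ι] (hv : IsUnimodularCircuit v) (k : ℕ) :
    ∃ L : (ι → ℤ) → Fin n → ℤ, Set.InjOn L (medianBall ι k) ∧
      {z : Fin n → ℤ | (fun i => (z i : ℝ)) ∈ absHull v Set.univ k} = L '' medianBall ι k := by
  choose L hL using hv.exists_int
  have hcast : ∀ z z' : Fin n → ℤ, (fun i => (z i : ℝ)) = (fun i => (z' i : ℝ)) → z = z' :=
    fun z z' h => funext fun i => by exact_mod_cast congrFun h i
  refine ⟨L, ?_, ?_⟩
  · intro w hw w' hw' h
    rw [Finset.mem_coe, mem_medianBall] at hw hw'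
    obtain ⟨s, hs⟩ := hv.const_of_map_eq_zero (fun i => (w i : ℝ) - w' i) (by
      have := congrArg (fun z : Fin n → ℤ => fun i => (z i : ℝ)) h
      simp only [← hL] at this
      rw [← sub_eq_zero, ← map_sub] at this
      exact this)
    have i₀ : ι := Classical.arbitrary ι
    -- The real constant is the difference at `i₀`, hence an integer, and uniqueness of the lower
    -- median forces it to be `0`.
    have hw2 : w = fun i => w' i + (w i₀ - w' i₀) := by
      ext i
      have h1 := congrFun hs i
      have h2 := congrFun hs i₀
      have : (w i : ℝ) = w' i + (w i₀ - w' i₀) := by linarith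
      exact_mod_cast this
    have h0 : IsLowerMedian w (0 + (w i₀ - w' i₀)) := by
      have := isLowerMedian_add_const (s := w i₀ - w' i₀).2 hw'.2
      rwa [← hw2] at this
    have h00 := h0.unique hw.2
    rw [hw2]
    ext i
    omega
  · ext z
    simp only [Set.mem_ofPred_eq, Set.mem_image, Finset.mem_coe, mem_medianBall]
    constructor
    · rintro ⟨c, -, hc, hz⟩
      obtain ⟨w, s, rfl⟩ := hv.exists_lift c z hz
      obtain ⟨t, ht⟩ := exists_isLowerMedian w
      refine ⟨fun i => w i + -t, ⟨?_, ?_⟩, ?_⟩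
      -- The given coefficients are `w` shifted by the real `s`; shifting by `-t` instead gives no
      -- larger norm.
      · have h := (ht.sum_abs_sub_le (-s)).trans (by simpa using hc)
        have : ((∑ i, (w i + -t).natAbs : ℕ) : ℝ) ≤ k := by
          push_cast
          simpa [Nat.cast_natAbs, ← sub_eq_add_neg] using h
        exact_mod_cast this
      · simpa using (isLowerMedian_add_const (s := -t)).2 ht
      · apply hcast
        rw [← hL, ← hz, ← sub_eq_zero, ← map_sub, ← hv.map_const (-t - s)]
        congr 1
        ext i
        simp
    · rintro ⟨w, ⟨hw, -⟩, rfl⟩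
      refine ⟨fun i => (w i : ℝ), trivial, ?_, hL w⟩
      have : ((∑ i, (w i).natAbs : ℕ) : ℝ) ≤ k := by exact_mod_cast hw
      simpa [Nat.cast_natAbs] using this

theorem finite_lattice_points [Nonempty ι] (hv : IsUnimodularCircuit v) (k : ℕ) :
    {z : Fin n → ℤ | (fun i => (z i : ℝ)) ∈ absHull v Set.univ k}.Finite := by
  obtain ⟨L, _, h⟩ := hv.exists_image_medianBall k
  rw [h]
  exact (Finset.finite_toSet _).image L

theorem ncard_lattice_points [Nonempty ι] (hv : IsUnimodularCircuit v) (k : ℕ) :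
    {z : Fin n → ℤ | (fun i => (z i : ℝ)) ∈ absHull v Set.univ k}.ncard =
      (medianBall ι k).card := by
  obtain ⟨L, hL, h⟩ := hv.exists_image_medianBall k
  rw [h, hL.ncard_image, Set.ncard_coe_finset]

end IsUnimodularCircuit

theorem latticeCount_absHull {v : ι → Fin n → ℝ} {K : Set (ι → ℝ)}
    (hK : ∀ c ∈ K, ∀ r : ℝ, 0 < r → r • c ∈ K) {k : ℕ} (hk : k ≠ 0) :
    latticeCount (absHull v K 1) k =
      {z : Fin n → ℤ | (fun i => (z i : ℝ)) ∈ absHull v K k}.ncard := by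
  rw [latticeCount, mem_smul_absHull hK (by positivity)]

theorem coe_sum_C_mul_X_pow (N : ℕ) (f : ℕ → ℤ) :
    ((∑ a ∈ Finset.range N, Polynomial.C (f a) * Polynomial.X ^ a : Polynomial ℤ) :
      PowerSeries ℤ) = ∑ a ∈ Finset.range N, PowerSeries.C (f a) * PowerSeries.X ^ a := by
  rw [← Polynomial.coeToPowerSeries.ringHom_apply, map_sum]
  simp [-eq_intCast]

theorem one_sub_X_ne_zero : (1 - PowerSeries.X : PowerSeries ℤ) ≠ 0 := by
  intro h
  simpa using congrArg (PowerSeries.coeff 0) h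

/-- The ball lives in dimension `m + 1`, so its series has denominator `(1 - x)^(m+2)`; the extra
factor cancels the `1 - X` in `one_sub_X_mul_centralGamma`. -/
theorem mk_card_medianBall_mul_one_sub_pow {m : ℕ} (hm : Fintype.card ι = m + 1) :
    (PowerSeries.mk fun k => ((medianBall ι k).card : ℤ)) * (1 - PowerSeries.X) ^ (m + 1) =
      (centralGamma m : PowerSeries ℤ) := by
  apply mul_right_cancel₀ one_sub_X_ne_zero
  simp only [card_medianBall]
  rw [mul_assoc, ← pow_succ, ← hm, mk_sum_l1Ball_mul_one_sub_pow,
    ← coe_sum_C_mul_X_pow _ fun a => (Fintype.card ι).choose a * balanceSign (Fintype.card ι) a]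
  change (signedBinomial (Fintype.card ι) : PowerSeries ℤ) = _
  rw [hm, ← one_sub_X_mul_centralGamma, mul_comm]
  simp

theorem mk_card_l1Ball_mul_one_sub_pow :
    (PowerSeries.mk fun k => ((l1Ball ι k).card : ℤ)) *
        (1 - PowerSeries.X) ^ (Fintype.card ι + 1) =
      (((Polynomial.X + 1) ^ Fintype.card ι : Polynomial ℤ) : PowerSeries ℤ) := by
  have h := mk_sum_l1Ball_mul_one_sub_pow (ι := ι) fun _ => 1
  simp only [Finset.sum_const, nsmul_eq_mul, mul_one] at h
  rw [h, ← coe_sum_C_mul_X_pow _ fun a => ((Fintype.card ι).choose a : ℤ), add_pow]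
  congr 1
  refine Finset.sum_congr rfl fun a _ => ?_
  simp [mul_comm]

theorem IsUnimodularCircuit.isHStarPolynomial {v : ι → Fin n → ℝ} (hv : IsUnimodularCircuit v)
    {m : ℕ} (hm : Fintype.card ι = m + 1) :
    IsHStarPolynomial (absHull v Set.univ 1) (centralGamma m) := by
  have : Nonempty ι := Fintype.card_pos_iff.1 (by omega)
  rw [IsHStarPolynomial, hv.polytopeDim_absHull (Set.mem_univ _) fun _ => Set.mem_univ _, hm,
    ← mk_card_medianBall_mul_one_sub_pow hm]
  congr 1
  ext k
  rw [ehrhartSeries, PowerSeries.coeff_mk, PowerSeries.coeff_mk]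
  split_ifs with hk
  · rw [hk, medianBall_zero, Finset.card_singleton, Nat.cast_one]
  · rw [latticeCount_absHull (fun _ _ _ _ => Set.mem_univ _) hk, hv.ncard_lattice_points]

end AbsHull

/-! ### The cycle -/

section Cycle

/-- Telescoping along the cycle. `A = ⊥` yields the uniqueness of the relation, and `A = ℤ` the
integral lifts. -/
theorem cyclic_sub_mem {p : ℕ} (A : AddSubgroup ℝ) (c : Fin (p + 2) → ℝ)
    (h : ∀ j, c j - c (j - 1) ∈ A) (j : Fin (p + 2)) : c j - c 0 ∈ A := by
  induction j using Fin.induction with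
  | zero => simp
  | succ j ih =>
    have h1 := h j.succ
    rw [← Fin.coeSucc_eq_succ, add_sub_cancel_right, Fin.coeSucc_eq_succ] at h1
    simpa using A.add_mem h1 ih

/-- The vectors `e_i - e_{i+1}` of the cycle. -/
def cycleVec (p : ℕ) (i : Fin (p + 2)) : Fin (p + 2) → ℝ := unitVec i - unitVec (i + 1)

theorem linearCombination_cycleVec {p : ℕ} (c : Fin (p + 2) → ℝ) (j : Fin (p + 2)) :
    Fintype.linearCombination ℝ (cycleVec p) c j = c j - c (j - 1) := by
  rw [Fintype.linearCombination_apply, Finset.sum_apply]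
  have h : ∀ i, (c i • cycleVec p i) j = (if j = i then c i else 0) - if j - 1 = i then c i else 0 := by
    intro i
    simp [cycleVec, unitVec, Pi.single_apply, mul_sub, sub_eq_iff_eq_add]
  simp [h]

theorem isUnimodularCircuit_cycleVec (p : ℕ) : IsUnimodularCircuit (cycleVec p) where
  map_const s := by ext j; simp [linearCombination_cycleVec]
  const_of_map_eq_zero c hc := by
    refine ⟨c 0, funext fun j => ?_⟩
    have := cyclic_sub_mem ⊥ c (fun j => by
      rw [← linearCombination_cycleVec, hc]; simp) j
    simpa [sub_eq_zero] using this
  exists_int w := ⟨fun j => w j - w (j - 1), by ext j; simp [linearCombination_cycleVec]⟩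
  exists_lift c z hz := by
    have := cyclic_sub_mem (Int.castAddHom ℝ).range c (fun j => by
      rw [← linearCombination_cycleVec, hz]; exact ⟨z j, rfl⟩)
    choose w hw using this
    refine ⟨w, c 0, funext fun j => ?_⟩
    have := hw j
    simp at this
    simp [this]

theorem symmetricEdgePolytope_cycleGraph (p : ℕ) :
    symmetricEdgePolytope (SimpleGraph.cycleGraph (p + 2)) = absHull (cycleVec p) Set.univ 1 := by
  have hmem : ∀ i, cycleVec p i ∈ {v | ∃ i j, (SimpleGraph.cycleGraph (p + 2)).Adj i j ∧
      v = unitVec i - unitVec j} := fun i =>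
    ⟨i, i + 1, by rw [SimpleGraph.cycleGraph_adj]; simp, rfl⟩
  have hmem' : ∀ i, -cycleVec p i ∈ {v | ∃ i j, (SimpleGraph.cycleGraph (p + 2)).Adj i j ∧
      v = unitVec i - unitVec j} := fun i =>
    ⟨i + 1, i, by rw [SimpleGraph.cycleGraph_adj]; simp, by simp [cycleVec]⟩
  refine convexHull_eq_absHull convex_univ ?_ (zero_mem_convexHull_of_neg_mem (hmem 0) (hmem' 0))
    (fun _ _ i _ => hmem i) (fun _ _ i _ => hmem' i)
  rintro _ ⟨i, j, hij, rfl⟩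
  rw [SimpleGraph.cycleGraph_adj, sub_eq_iff_eq_add', sub_eq_iff_eq_add'] at hij
  rcases hij with rfl | rfl
  · refine ⟨-Pi.single j 1, trivial, by simp [Pi.single_apply, apply_ite abs], ?_⟩
    simp [cycleVec]
  · refine ⟨Pi.single i 1, trivial, by simp [Pi.single_apply, apply_ite abs], ?_⟩
    simp [cycleVec]

end Cycle

/-! ### The del Pezzo polytopes -/

section DelPezzo

/-- The vectors `-e_1 - ⋯ - e_n, e_1, …, e_n`. -/
def delPezzoVec (n : ℕ) : Fin (n + 1) → Fin n → ℝ :=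
  Fin.cons (-∑ i, unitVec i) unitVec

theorem linearCombination_delPezzoVec {n : ℕ} (c : Fin (n + 1) → ℝ) (j : Fin n) :
    Fintype.linearCombination ℝ (delPezzoVec n) c j = c j.succ - c 0 := by
  rw [Fintype.linearCombination_apply, Finset.sum_apply, Fin.sum_univ_succ]
  simp [delPezzoVec, unitVec, Pi.single_apply, Finset.sum_apply]
  ring

theorem isUnimodularCircuit_delPezzoVec (n : ℕ) : IsUnimodularCircuit (delPezzoVec n) where
  map_const s := by ext j; simp [linearCombination_delPezzoVec]
  const_of_map_eq_zero c hc := by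
    refine ⟨c 0, funext fun j => ?_⟩
    induction j using Fin.cases with
    | zero => rfl
    | succ j =>
      have := congrFun hc j
      rw [linearCombination_delPezzoVec] at this
      exact sub_eq_zero.1 this
  exists_int w := ⟨fun j => w j.succ - w 0, by ext j; simp [linearCombination_delPezzoVec]⟩
  exists_lift c z hz := by
    -- The coordinates of the image are `c j.succ - c 0`, so subtracting `c 0` from `c` leaves `0`
    -- followed by `z`.
    refine ⟨Fin.cons 0 z, c 0, funext fun j => ?_⟩
    induction j using Fin.cases with
    | zero => simp
    | succ j =>
      have := congrFun hz j
      rw [linearCombination_delPezzoVec] at this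
      simp [← this]

theorem delPezzoPolytope_eq {m : ℕ} (hm : 1 ≤ m) :
    delPezzoPolytope m = absHull (delPezzoVec (2 * m)) Set.univ 1 := by
  refine convexHull_eq_absHull convex_univ ?_
    (zero_mem_convexHull_of_neg_mem (x := unitVec ⟨0, by omega⟩) (Or.inl ⟨_, Or.inl rfl⟩)
      (Or.inl ⟨_, Or.inr rfl⟩)) ?_ ?_
  · have hc : ∀ i, ∑ j, |(Pi.single i 1 : Fin (2 * m + 1) → ℝ) j| ≤ 1 := fun i => by
      simp [Pi.single_apply, apply_ite abs]
    rintro _ (⟨i, rfl | rfl⟩ | rfl | rfl)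
    · exact ⟨Pi.single i.succ 1, trivial, hc _, by simp [delPezzoVec]⟩
    · exact ⟨-Pi.single i.succ 1, trivial, by simpa using hc i.succ, by simp [delPezzoVec]⟩
    · exact ⟨-Pi.single 0 1, trivial, by simpa using hc 0, by simp [delPezzoVec]⟩
    · exact ⟨Pi.single 0 1, trivial, hc _, by simp [delPezzoVec]⟩
  · intro c _ i _
    induction i using Fin.cases with
    | zero => exact Or.inr (Or.inr rfl)
    | succ i => exact Or.inl ⟨i, Or.inl rfl⟩
  · intro c _ i _
    induction i using Fin.cases with
    | zero => exact Or.inr (Or.inl (by simp [delPezzoVec]))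
    | succ i => exact Or.inl ⟨i, Or.inr rfl⟩

theorem pseudoDelPezzoPolytope_eq {m : ℕ} (hm : 1 ≤ m) :
    pseudoDelPezzoPolytope m = absHull (delPezzoVec (2 * m)) {c | 0 ≤ c 0} 1 := by
  refine convexHull_eq_absHull ?_ ?_
    (zero_mem_convexHull_of_neg_mem (x := unitVec ⟨0, by omega⟩) (Or.inl ⟨_, Or.inl rfl⟩)
      (Or.inl ⟨_, Or.inr rfl⟩)) ?_ ?_
  · intro c hc c' hc' a b ha hb _
    simp only [Set.mem_ofPred_eq, Pi.add_apply, Pi.smul_apply, smul_eq_mul] at *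
    positivity
  · have hc : ∀ i, ∑ j, |(Pi.single i 1 : Fin (2 * m + 1) → ℝ) j| ≤ 1 := fun i => by
      simp [Pi.single_apply, apply_ite abs]
    rintro _ (⟨i, rfl | rfl⟩ | rfl)
    · exact ⟨Pi.single i.succ 1, by simp, hc _, by simp [delPezzoVec]⟩
    · exact ⟨-Pi.single i.succ 1, by simp, by simpa using hc i.succ, by simp [delPezzoVec]⟩
    · exact ⟨Pi.single 0 1, by simp, hc _, by simp [delPezzoVec]⟩
  · intro c _ i _
    induction i using Fin.cases with
    | zero => exact Or.inr rfl
    | succ i => exact Or.inl ⟨i, Or.inl rfl⟩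
  · intro c hc i hi
    induction i using Fin.cases with
    | zero => exact absurd hi (not_lt.2 hc)
    | succ i => exact Or.inl ⟨i, Or.inr rfl⟩

theorem absHull_delPezzoVec_inter {n : ℕ} (r : ℝ) :
    absHull (delPezzoVec n) {c | 0 ≤ c 0} r ∩ absHull (delPezzoVec n) {c | c 0 ≤ 0} r =
      {x | ∑ i, |x i| ≤ r} := by
  ext x
  constructor
  · rintro ⟨⟨c, hc, hcr, rfl⟩, c', hc', hcr', hx⟩
    simp only [Set.mem_ofPred_eq] at hc hc' ⊢
    obtain ⟨a, b, ha, hb, hab, h0⟩ : ∃ a b : ℝ, 0 ≤ a ∧ 0 ≤ b ∧ a + b = 1 ∧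
        a * c 0 + b * c' 0 = 0 := by
      rcases hc.eq_or_lt with h | h
      · exact ⟨1, 0, by norm_num, le_rfl, by norm_num, by simp [← h]⟩
      · have hpos : 0 < c 0 - c' 0 := by linarith
        refine ⟨-c' 0 / (c 0 - c' 0), c 0 / (c 0 - c' 0), div_nonneg (by linarith) hpos.le,
          div_nonneg hc hpos.le, ?_, ?_⟩ <;> field_simp <;> ring
    have h := sum_abs_combo_le hcr hcr' ha hb hab
    rw [Fin.sum_univ_succ] at h
    refine le_trans (Finset.sum_le_sum fun i _ => le_of_eq ?_)
      ((le_add_of_nonneg_left (abs_nonneg _)).trans h)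
    have h1 := congrFun hx i
    rw [linearCombination_delPezzoVec, linearCombination_delPezzoVec] at h1
    rw [linearCombination_delPezzoVec]
    congr 1
    simp only [Pi.add_apply, Pi.smul_apply, smul_eq_mul]
    linear_combination -b * h1 - h0 - (c i.succ - c 0) * hab
  · intro hx
    have h : ∀ K : Set (Fin (n + 1) → ℝ), (Fin.cons 0 x : Fin (n + 1) → ℝ) ∈ K →
        x ∈ absHull (delPezzoVec n) K r := fun K hK =>
      ⟨Fin.cons 0 x, hK, by simpa [Fin.sum_univ_succ] using hx, by
        ext j; simp [linearCombination_delPezzoVec]⟩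
    exact ⟨h _ (by simp), h _ (by simp)⟩

/-- Inclusion-exclusion for the halves `0 ≤ c 0` and `c 0 ≤ 0`, which negation exchanges. -/
theorem two_mul_latticeCount_pseudo {n k : ℕ} (hk : k ≠ 0) :
    2 * latticeCount (absHull (delPezzoVec n) {c | 0 ≤ c 0} 1) k =
      (medianBall (Fin (n + 1)) k).card + (l1Ball (Fin n) k).card := by
  rw [latticeCount_absHull (fun c hc r hr => by
    simp only [Set.mem_ofPred_eq, Pi.smul_apply, smul_eq_mul] at *; positivity) hk]
  set A := {z : Fin n → ℤ | (fun i => (z i : ℝ)) ∈ absHull (delPezzoVec n) {c | 0 ≤ c 0} k} with hA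
  set B := {z : Fin n → ℤ | (fun i => (z i : ℝ)) ∈ absHull (delPezzoVec n) {c | c 0 ≤ 0} k} with hB
  have hU : A ∪ B =
      {z : Fin n → ℤ | (fun i => (z i : ℝ)) ∈ absHull (delPezzoVec n) Set.univ k} := by
    ext z
    constructor
    · rintro (⟨c, -, h⟩ | ⟨c, -, h⟩) <;> exact ⟨c, trivial, h⟩
    · rintro ⟨c, -, h⟩
      exact (le_total 0 (c 0)).imp (fun h0 => ⟨c, h0, h⟩) fun h0 => ⟨c, h0, h⟩
  have hI : A ∩ B = (l1Ball (Fin n) k : Set (Fin n → ℤ)) := by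
    ext z
    have h := Set.ext_iff.1 (absHull_delPezzoVec_inter (n := n) k) fun i => (z i : ℝ)
    refine h.trans ?_
    rw [Finset.mem_coe, mem_l1Ball, Set.mem_ofPred_eq, ← Nat.cast_le (α := ℝ)]
    simp [Nat.cast_natAbs]
  have hAB : B.ncard = A.ncard := by
    refine Set.ncard_congr (fun z _ => -z) ?_ (fun _ _ _ _ h => neg_injective h) ?_
    · rintro z ⟨c, h0, hc, hz⟩
      refine ⟨-c, by simpa using h0, by simpa using hc, ?_⟩
      rw [map_neg, hz]
      ext; simp
    · rintro z ⟨c, h0, hc, hz⟩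
      refine ⟨-z, ⟨-c, by simpa using h0, by simpa using hc, ?_⟩, neg_neg z⟩
      rw [map_neg, hz]
      ext; simp
  have hfin := (isUnimodularCircuit_delPezzoVec n).finite_lattice_points k
  rw [← hU] at hfin
  have h := Set.ncard_union_add_ncard_inter A B (hfin.subset Set.subset_union_left)
    (hfin.subset Set.subset_union_right)
  rw [hU, hI, (isUnimodularCircuit_delPezzoVec n).ncard_lattice_points, Set.ncard_coe_finset,
    hAB] at h
  omega

theorem isHStarPolynomial_pseudo {n : ℕ} {h : Polynomial ℤ}
    (hh : 2 * h = (Polynomial.X + 1) ^ n + centralGamma n) :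
    IsHStarPolynomial (absHull (delPezzoVec n) {c | 0 ≤ c 0} 1) h := by
  rw [IsHStarPolynomial, (isUnimodularCircuit_delPezzoVec n).polytopeDim_absHull (by simp)
    (fun i => (Pi.single_nonneg.2 zero_le_one : (0 : Fin (n + 1) → ℝ) ≤ Pi.single i 1) 0), Fintype.card_fin]
  have h2 : (h : PowerSeries ℤ) + h =
      (((Polynomial.X + 1) ^ n : Polynomial ℤ) : PowerSeries ℤ) +
        (centralGamma n : PowerSeries ℤ) := by
    rw [← Polynomial.coe_add, ← Polynomial.coe_add, ← hh, two_mul]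
  have hl := mk_card_l1Ball_mul_one_sub_pow (ι := Fin n)
  rw [Fintype.card_fin] at hl
  have two_ne : (2 : PowerSeries ℤ) ≠ 0 := fun h => by
    rw [← one_add_one_eq_two] at h
    simpa using congrArg PowerSeries.constantCoeff h
  apply mul_left_cancel₀ two_ne
  rw [two_mul (h : PowerSeries ℤ), h2, ← hl,
    ← mk_card_medianBall_mul_one_sub_pow (Fintype.card_fin (n + 1)), ← mul_assoc, ← add_mul]
  congr 1
  ext k
  rw [two_mul, ehrhartSeries, map_add, map_add, PowerSeries.coeff_mk, PowerSeries.coeff_mk,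
    PowerSeries.coeff_mk]
  split_ifs with hk
  -- The constant term of the Ehrhart series is `1` by convention, and both balls of radius `0` are
  -- singletons.
  · rw [hk, medianBall_zero, l1Ball_zero, Finset.card_singleton, Finset.card_singleton,
      Nat.cast_one]
  · have := two_mul_latticeCount_pseudo (n := n) hk
    omega

end DelPezzo

/-! ### The main theorem -/

section Main

open Polynomial

theorem isGammaPositive_centralGamma (n : ℕ) :
    IsGammaPositive ((centralGamma n).map (Int.castRingHom ℝ)) := by
  refine isGammaPositive_of_eq_sum n (fun i => (2 * i).choose i) (by simp)
    (fun i => Nat.cast_nonneg _) ?_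
  simp [centralGamma, Polynomial.map_sum, add_comm]

theorem isHStarPolynomial_cycleGraph {d : ℕ} (hd : 3 ≤ d) :
    IsHStarPolynomial (symmetricEdgePolytope (SimpleGraph.cycleGraph d)) (centralGamma (d - 1)) := by
  obtain ⟨p, rfl⟩ := Nat.exists_eq_add_of_le' (show 2 ≤ d by omega)
  rw [symmetricEdgePolytope_cycleGraph]
  exact (isUnimodularCircuit_cycleVec p).isHStarPolynomial (Fintype.card_fin _)

theorem isHStarPolynomial_delPezzoPolytope {m : ℕ} (hm : 1 ≤ m) :
    IsHStarPolynomial (delPezzoPolytope m) (centralGamma (2 * m)) := by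
  rw [delPezzoPolytope_eq hm]
  exact (isUnimodularCircuit_delPezzoVec _).isHStarPolynomial (Fintype.card_fin _)

theorem isHStarPolynomial_pseudoDelPezzoPolytope {m : ℕ} (hm : 1 ≤ m) :
    IsHStarPolynomial (pseudoDelPezzoPolytope m)
      ((X + 1) ^ (2 * m) + ∑ i ∈ Finset.Icc 1 m,
        ((2 * i - 1).choose (i - 1) : ℤ[X]) * X ^ i * (X + 1) ^ (2 * m - 2 * i)) := by
  rw [pseudoDelPezzoPolytope_eq hm]
  exact isHStarPolynomial_pseudo (two_mul_pseudoGamma m)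

theorem isGammaPositive_pseudo (m : ℕ) :
    IsGammaPositive (((X + 1) ^ (2 * m) + ∑ i ∈ Finset.Icc 1 m,
      ((2 * i - 1).choose (i - 1) : ℤ[X]) * X ^ i * (X + 1) ^ (2 * m - 2 * i)).map
        (Int.castRingHom ℝ)) := by
  refine isGammaPositive_of_eq_sum (2 * m)
    (fun i => if i = 0 then 1 else ((2 * i - 1).choose (i - 1) : ℕ)) (by simp)
    (fun i => by split_ifs <;> positivity) ?_
  rw [show 2 * m / 2 = m by omega, Finset.range_eq_Ico,
    Finset.sum_eq_sum_Ico_succ_bot (by omega)]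
  simp only [Polynomial.map_add, Polynomial.map_sum, Polynomial.map_pow, map_X, Polynomial.map_one,
    Polynomial.map_mul, Polynomial.map_natCast, if_true, C_1, pow_zero, mul_one, one_mul, mul_zero,
    Nat.sub_zero, add_comm (X : ℝ[X]) 1]
  congr 1
  refine Finset.sum_congr (by ext; simp) fun i hi => ?_
  rw [Finset.mem_Ico] at hi
  rw [if_neg (by omega), map_natCast]

end Main

end

theorem mainTheorem8 :
    (∀ d : ℕ, 3 ≤ d →
      IsHStarPolynomial (symmetricEdgePolytope (SimpleGraph.cycleGraph d))
        (∑ i ∈ Finset.range ((d - 1) / 2 + 1),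
          ((2 * i).choose i : Polynomial ℤ) * Polynomial.X ^ i *
            (Polynomial.X + 1) ^ (d - 2 * i - 1))) ∧
    (∀ m : ℕ, 1 ≤ m →
      IsHStarPolynomial (delPezzoPolytope m)
        (∑ i ∈ Finset.range (m + 1),
          ((2 * i).choose i : Polynomial ℤ) * Polynomial.X ^ i *
            (Polynomial.X + 1) ^ (2 * m - 2 * i))) ∧
    (∀ m : ℕ, 1 ≤ m →
      IsHStarPolynomial (pseudoDelPezzoPolytope m)
        ((Polynomial.X + 1) ^ (2 * m) +
          ∑ i ∈ Finset.Icc 1 m,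
            ((2 * i - 1).choose (i - 1) : Polynomial ℤ) * Polynomial.X ^ i *
              (Polynomial.X + 1) ^ (2 * m - 2 * i))) ∧
    (∀ d : ℕ, 3 ≤ d → ∃ h : Polynomial ℤ,
      IsHStarPolynomial (symmetricEdgePolytope (SimpleGraph.cycleGraph d)) h ∧
        IsGammaPositive (h.map (Int.castRingHom ℝ))) ∧
    (∀ m : ℕ, 1 ≤ m → ∃ h : Polynomial ℤ,
      IsHStarPolynomial (delPezzoPolytope m) h ∧
        IsGammaPositive (h.map (Int.castRingHom ℝ))) ∧
    (∀ m : ℕ, 1 ≤ m → ∃ h : Polynomial ℤ,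
      IsHStarPolynomial (pseudoDelPezzoPolytope m) h ∧
        IsGammaPositive (h.map (Int.castRingHom ℝ))) := by
  have hcycle : ∀ d : ℕ, centralGamma (d - 1) = ∑ i ∈ Finset.range ((d - 1) / 2 + 1),
      ((2 * i).choose i : Polynomial ℤ) * Polynomial.X ^ i *
        (Polynomial.X + 1) ^ (d - 2 * i - 1) := fun d => by
    simp only [centralGamma, Nat.sub_right_comm d 1]
  have hpezzo : ∀ m : ℕ, centralGamma (2 * m) = ∑ i ∈ Finset.range (m + 1),
      ((2 * i).choose i : Polynomial ℤ) * Polynomial.X ^ i *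
        (Polynomial.X + 1) ^ (2 * m - 2 * i) := fun m => by
    rw [centralGamma, Nat.mul_div_cancel_left m two_pos]
  exact ⟨fun d hd => hcycle d ▸ isHStarPolynomial_cycleGraph hd,
    fun m hm => hpezzo m ▸ isHStarPolynomial_delPezzoPolytope hm,
    fun m hm => isHStarPolynomial_pseudoDelPezzoPolytope hm,
    fun d hd => ⟨_, isHStarPolynomial_cycleGraph hd, isGammaPositive_centralGamma _⟩,
    fun m hm => ⟨_, isHStarPolynomial_delPezzoPolytope hm, isGammaPositive_centralGamma _⟩,
    fun m hm => ⟨_, isHStarPolynomial_pseudoDelPezzoPolytope hm, isGammaPositive_pseudo m⟩⟩
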